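/- For every sample size $n$, let $p=p_n\ge 1$, let $K=K_n\subseteq\mathbb{R}^{p}$ be a convex set, let $\Sigma=\Sigma_n$ be a positive semidefinite $p\times p$ matrix, and let $j=j_n\in\{1,\dots,p\}$. Let $\sigma>0$, $\alpha\in(0,1)$ and $\delta>0$ be fixed, and suppose that $\|\Sigma_n^{1/2}\|_{\mathrm{op}}\ge c$ for all $n$ and some constant $c>0$. For $\beta\in\mathbb{R}^p$ let $\mathbb{P}_\beta$ be the law of the data $(X,Y)=(X_i,Y_i)_{i=1}^n$ with $Y_i=X_i^\top\beta+\varepsilon_i$, where $X_i\sim N(0,\Sigma)$ and $\varepsilon_i\sim N(0,\sigma^2)$, all of them independent. Write $\mathcal{T}_K(v)=\{t(x-v): t\ge 0,\ x\in K\}$ for the tangent cone of $K$ at $v\in K$, and $w(T)=\mathbb{E}\sup_{x\in T}\langle g,x\rangle$, $g\sim N(0,I_p)$, for the Gaussian complexity of $T\subseteq\mathbb{R}^p$ (with $w(\varnothing)=0$). For every $n$ and $v\in K$ let $\overline w(v)=\overline w_n(v)\in\mathbb{R}$ be an upper bound of $w(\mathcal{T}_K(v)\cap\mathbb{S}^{p-1})$,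 such that $\overline w_n(v)\to\infty$ uniformly over $v\in K_n$ as $n\to\infty$. Put $$ r_n=\inf_{\beta\in S}\frac{\overline w^2(\beta)}{\sqrt n},\qquad S=\Big\{\beta\in K:\ \beta+\tfrac{\delta\sigma\|\Sigma^{1/2}\|_{\mathrm{op}}^{-1}}{\sqrt n}e_j\in K\ \text{ or }\ \beta-\tfrac{\delta\sigma\|\Sigma^{1/2}\|_{\mathrm{op}}^{-1}}{\sqrt n}e_j\in K\Big\}, $$ with $r_n=\infty$ if $S=\varnothing$. Suppose that $r_n=o(1)$, let $R_n$ be real numbers with $R_n=o(1)$ and $R_n\ge 2r_n$ for all sufficiently large $n$, and let $$ \mathcal{H}=\mathcal{H}(R_n)=\Big\{\beta\in K:\ \text{there is } v\in K \text{ with } \|\beta-v\|^2\le \tfrac{R_n}{\sqrt n}\ \text{ and }\ \overline w^2(v)\le R_n\sqrt n\Big\}. $$ Let $\mathcal{I}_\alpha(\mathcal{H})$ be the set of all intervals $[l(X,Y),u(X,Y)]$, with measurable real-valued $l,u$, such that $\inf_{\beta\in\mathcal{H}}\mathbb{P}_\beta\big(l(X,Y)\le e_j^\top\beta\le u(X,Y)\big)\ge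 1-\alpha$. Then, for all sufficiently large $n$, $$ \inf_{[l,u]\in\mathcal{I}_\alpha(\mathcal{H})}\ \sup_{\beta\in\mathcal{H}}\ \mathbb{E}_\beta\big[(u(X,Y)-l(X,Y))_+\big]\ \ge\ \delta\Big(1-2\alpha-\sqrt{\exp(2\delta^2)-1}\Big)\frac{\sigma\|\Sigma^{1/2}\|_{\mathrm{op}}^{-1}}{\sqrt n}, $$ where $(u-l)_+=\max(u-l,0)$ is the length of $[l,u]$. -/

import Mathlib

namespace DebiasCI

open MeasureTheory ProbabilityTheory
open scoped MatrixOrder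

noncomputable section

/-- The tangent cone `{t (v - x) : t ≥ 0, v ∈ K}` of a convex set `K` at `x`. -/
def tangentCone {p : ℕ} (K : Set (EuclideanSpace ℝ (Fin p))) (x : EuclideanSpace ℝ (Fin p)) :
    Set (EuclideanSpace ℝ (Fin p)) :=
  {y | ∃ t : ℝ, 0 ≤ t ∧ ∃ v ∈ K, y = t • (v - x)}

/-- The Gaussian complexity `w(T) = E sup_{x ∈ T} ⟨g, x⟩` with `g ∼ N(0, I_p)`, for bounded `T`
(the supremum is then finite and Lipschitz in `g`; the value for empty `T` is `0`). -/
def gaussianComplexity {p : ℕ} (T : Set (EuclideanSpace ℝ (Fin p))) : ℝ :=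
  ∫ g, (⨆ x : T, inner ℝ g (x : EuclideanSpace ℝ (Fin p)))
    ∂(stdGaussian (EuclideanSpace ℝ (Fin p)))

/-- `w(T_K(v) ∩ S^{p-1})`. -/
def tangentComplexity {p : ℕ} (K : Set (EuclideanSpace ℝ (Fin p)))
    (v : EuclideanSpace ℝ (Fin p)) : ℝ :=
  gaussianComplexity (tangentCone K v ∩ Metric.sphere 0 1)

/-- The Euclidean operator norm `‖Σ^{1/2}‖` of the positive semidefinite square root of `Σ`. -/
def sqrtOpNorm {p : ℕ} (Sig : Matrix (Fin p) (Fin p) ℝ) : ℝ :=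
  ‖Matrix.toEuclideanCLM (𝕜 := ℝ) (CFC.sqrt Sig)‖

/-- The data `(X, Y)`: `n` rows `X_i ∈ ℝ^p` and `n` responses `Y_i ∈ ℝ`. -/
abbrev Data (n p : ℕ) : Type := (Fin n → EuclideanSpace ℝ (Fin p)) × (Fin n → ℝ)

/-- The law `P_β` of `(X, Y)`, where `Y_i = X_iᵀ β + ε_i`, the `X_i ∼ N(0, Σ)` are i.i.d., the
`ε_i ∼ N(0, σ²)` are i.i.d., and the design is independent of the noise. -/
def dataLaw (n : ℕ) {p : ℕ} (Sig : Matrix (Fin p) (Fin p) ℝ) (σ : ℝ)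
    (β : EuclideanSpace ℝ (Fin p)) : Measure (Data n p) :=
  ((Measure.pi fun _ : Fin n => multivariateGaussian 0 Sig).prod
      (Measure.pi fun _ : Fin n => gaussianReal 0 (σ ^ 2).toNNReal)).map
    fun z => (z.1, fun i => inner ℝ (z.1 i) β + z.2 i)

/-- A data-dependent interval `[l(X, Y), u(X, Y)]` (empty where `u < l`). -/
structure DataInterval (n p : ℕ) where
  lower : Data n p → ℝ
  upper : Data n p → ℝ
  measurable_lower : Measurable lower
  measurable_upper : Measurable upper

/-- The set `I_α(Θ)` of the intervals which contain `e_jᵀ β` with `P_β`-probability at least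
`1 - α`, for all `β ∈ Θ`. -/
def validIntervals (n : ℕ) {p : ℕ} (Sig : Matrix (Fin p) (Fin p) ℝ) (σ : ℝ) (j : Fin p) (α : ℝ)
    (Θ : Set (EuclideanSpace ℝ (Fin p))) : Set (DataInterval n p) :=
  {I | ENNReal.ofReal (1 - α) ≤
    ⨅ β ∈ Θ, dataLaw n Sig σ β {z | I.lower z ≤ β j ∧ β j ≤ I.upper z}}

/-- The worst case expected length `sup_{β ∈ Θ} E_β (length of [l, u])`, possibly infinite. -/
def worstLength {n p : ℕ} (Sig : Matrix (Fin p) (Fin p) ℝ) (σ : ℝ) (I : DataInterval n p)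
    (Θ : Set (EuclideanSpace ℝ (Fin p))) : ENNReal :=
  ⨆ β ∈ Θ, ∫⁻ z, ENNReal.ofReal (I.upper z - I.lower z) ∂(dataLaw n Sig σ β)

/-- The set `S` of the `β ∈ K` such that `β + h e_j ∈ K` or `β - h e_j ∈ K`, where
`h = δ σ ‖Σ^{1/2}‖⁻¹ / √n`. -/
def shiftable (n : ℕ) {p : ℕ} (K : Set (EuclideanSpace ℝ (Fin p)))
    (Sig : Matrix (Fin p) (Fin p) ℝ) (σ δ : ℝ) (j : Fin p) : Set (EuclideanSpace ℝ (Fin p)) :=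
  {β | β ∈ K ∧
    (β + EuclideanSpace.single j (δ * σ * (sqrtOpNorm Sig)⁻¹ / √(n : ℝ)) ∈ K ∨
      β - EuclideanSpace.single j (δ * σ * (sqrtOpNorm Sig)⁻¹ / √(n : ℝ)) ∈ K)}

/-- `r_n = inf_{β ∈ S} wbar(β)² / √n`, equal to `∞` if `S = ∅`. -/
def rate (n : ℕ) {p : ℕ} (K : Set (EuclideanSpace ℝ (Fin p)))
    (wbar : EuclideanSpace ℝ (Fin p) → ℝ)
    (Sig : Matrix (Fin p) (Fin p) ℝ) (σ δ : ℝ) (j : Fin p) : ENNReal :=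
  ⨅ β ∈ shiftable n K Sig σ δ j, ENNReal.ofReal (wbar β ^ 2 / √(n : ℝ))

/-- The parameter space `H(R)` of the `β ∈ K` with `‖β - v‖² ≤ R / √n` for some `v ∈ K` with
`wbar(v)² ≤ R √n`. -/
def paramSpace (n : ℕ) {p : ℕ} (K : Set (EuclideanSpace ℝ (Fin p)))
    (wbar : EuclideanSpace ℝ (Fin p) → ℝ) (R : ℝ) : Set (EuclideanSpace ℝ (Fin p)) :=
  {β | β ∈ K ∧ ∃ v ∈ K, ‖β - v‖ ^ 2 ≤ R / √(n : ℝ) ∧ wbar v ^ 2 ≤ R * √(n : ℝ)}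

end

end DebiasCI

namespace DebiasCI

open MeasureTheory ProbabilityTheory
open scoped NNReal ENNReal MatrixOrder

/-! This is Le Cam's two-point method. Since `rate` is positive and at most half of `R n`, some `β`
in `shiftable` has `wbar β ^ 2 ≤ R √n`; then `β` and a neighbour `β + h e_j`, `|h| =
δσ‖Σ^{1/2}‖⁻¹/√n`, both lie in `paramSpace`. An interval valid at both points contains both
coordinates, hence has length at least `|h|`, with `P_β`-probability at least `1 - 2α - TV`
(`le_worstLength_of_shift`).

Given `X`, the two laws of `Y` differ by a Gaussian shift with `t = h² ∑ X_ij² / σ²`.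
`pi_gaussianReal_shift_le` bounds the change in probability by `t/s + s/2` for any `s > 0`. This is
linear in `t`, so averaging over the design needs only `E t = n h² Σ_jj / σ² ≤ δ²`, and yields `√2 δ
≤ √(exp(2δ²) - 1)`. -/

/-! ### Likelihood ratios of one-dimensional Gaussian shifts. -/

/-- The density of `N(a, v)` with respect to `N(0, v)`. -/
noncomputable def shiftDensity (v : ℝ≥0) (a x : ℝ) : ℝ :=
  Real.exp (a / v * x - a ^ 2 / (2 * v))

lemma shiftDensity_pos (v : ℝ≥0) (a x : ℝ) : 0 < shiftDensity v a x := Real.exp_pos _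

lemma measurable_shiftDensity (v : ℝ≥0) (a : ℝ) : Measurable (shiftDensity v a) := by
  unfold shiftDensity; fun_prop

lemma shiftDensity_eq (v : ℝ≥0) (a x : ℝ) :
    shiftDensity v a x = Real.exp (a / v * x) * Real.exp (-(a ^ 2 / (2 * v))) := by
  rw [shiftDensity, sub_eq_add_neg, Real.exp_add]

lemma shiftDensity_sq_eq (v : ℝ≥0) (a x : ℝ) :
    shiftDensity v a x ^ 2 = Real.exp (2 * a / v * x) * Real.exp (-(a ^ 2 / v)) := by
  rw [shiftDensity, ← Real.exp_nat_mul, ← Real.exp_add]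
  congr 1
  -- At `v = 0` the convention `x / 0 = 0` makes every exponent vanish.
  by_cases hv : (v : ℝ) = 0
  · simp [hv]
  · push_cast; field_simp; ring

lemma integrable_shiftDensity (v : ℝ≥0) (a : ℝ) :
    Integrable (shiftDensity v a) (gaussianReal 0 v) := by
  simp_rw [funext (shiftDensity_eq v a)]
  exact (integrable_exp_mul_gaussianReal _).mul_const _

lemma integrable_shiftDensity_sq (v : ℝ≥0) (a : ℝ) :
    Integrable (fun x => shiftDensity v a x ^ 2) (gaussianReal 0 v) := by
  simp_rw [shiftDensity_sq_eq v a]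
  exact (integrable_exp_mul_gaussianReal _).mul_const _

lemma integral_exp_mul_gaussianReal (v : ℝ≥0) (t : ℝ) :
    ∫ x, Real.exp (t * x) ∂(gaussianReal 0 v) = Real.exp (v * t ^ 2 / 2) := by
  have h := congrFun (mgf_fun_id_gaussianReal (μ := 0) (v := v)) t
  simpa [mgf] using h

lemma integral_shiftDensity {v : ℝ≥0} (hv : v ≠ 0) (a : ℝ) :
    ∫ x, shiftDensity v a x ∂(gaussianReal 0 v) = 1 := by
  have hv' : (v : ℝ) ≠ 0 := by exact_mod_cast hv
  simp_rw [shiftDensity_eq v a]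
  rw [integral_mul_const, integral_exp_mul_gaussianReal, ← Real.exp_add, Real.exp_eq_one_iff]
  field_simp
  ring

lemma integral_shiftDensity_sq {v : ℝ≥0} (hv : v ≠ 0) (a : ℝ) :
    ∫ x, shiftDensity v a x ^ 2 ∂(gaussianReal 0 v) = Real.exp (a ^ 2 / v) := by
  have hv' : (v : ℝ) ≠ 0 := by exact_mod_cast hv
  simp_rw [shiftDensity_sq_eq v a]
  rw [integral_mul_const, integral_exp_mul_gaussianReal, ← Real.exp_add]
  congr 1
  field_simp
  ring

lemma gaussianReal_eq_withDensity {v : ℝ≥0} (hv : v ≠ 0) (a : ℝ) :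
    gaussianReal a v =
      (gaussianReal 0 v).withDensity (fun x => ENNReal.ofReal (shiftDensity v a x)) := by
  have hv' : (v : ℝ) ≠ 0 := by exact_mod_cast hv
  rw [gaussianReal_of_var_ne_zero _ hv, gaussianReal_of_var_ne_zero _ hv,
    ← withDensity_mul _ (measurable_gaussianPDF 0 v) (measurable_shiftDensity v a).ennreal_ofReal]
  congr 1
  ext x
  simp only [Pi.mul_apply, gaussianPDF]
  rw [← ENNReal.ofReal_mul (gaussianPDFReal_nonneg _ _ _)]
  congr 1
  rw [gaussianPDFReal, gaussianPDFReal, shiftDensity, mul_assoc (√_)⁻¹, ← Real.exp_add]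
  congr 2
  field_simp
  ring

/-! ### Product Gaussian shifts and their total variation. -/

section Pi

variable {n : ℕ} {v : ℝ≥0}

/-- The density of `N(a, v I)` with respect to `N(0, v I)`. -/
noncomputable def shiftDensityPi (v : ℝ≥0) (a x : Fin n → ℝ) : ℝ :=
  ∏ i, shiftDensity v (a i) (x i)

lemma measurable_shiftDensityPi (a : Fin n → ℝ) : Measurable (shiftDensityPi v a) := by
  unfold shiftDensityPi
  exact Finset.measurable_prod _ fun i _ => (measurable_shiftDensity v (a i)).comp
    (measurable_pi_apply i)

lemma shiftDensityPi_nonneg (a x : Fin n → ℝ) : 0 ≤ shiftDensityPi v a x :=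
  Finset.prod_nonneg fun _ _ => (shiftDensity_pos _ _ _).le

lemma integrable_shiftDensityPi (a : Fin n → ℝ) :
    Integrable (shiftDensityPi v a) (Measure.pi fun _ : Fin n => gaussianReal 0 v) :=
  Integrable.fintype_prod fun i => integrable_shiftDensity v (a i)

lemma integrable_shiftDensityPi_sq (a : Fin n → ℝ) :
    Integrable (fun x => shiftDensityPi v a x ^ 2)
      (Measure.pi fun _ : Fin n => gaussianReal 0 v) := by
  simp_rw [shiftDensityPi, ← Finset.prod_pow]
  exact Integrable.fintype_prod (f := fun i x => shiftDensity v (a i) x ^ 2)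
    fun i => integrable_shiftDensity_sq v (a i)

lemma integral_shiftDensityPi (hv : v ≠ 0) (a : Fin n → ℝ) :
    ∫ x, shiftDensityPi v a x ∂(Measure.pi fun _ : Fin n => gaussianReal 0 v) = 1 := by
  simp_rw [shiftDensityPi]
  rw [integral_fintype_prod_eq_prod]
  simp [integral_shiftDensity hv]

lemma integral_shiftDensityPi_sq (hv : v ≠ 0) (a : Fin n → ℝ) :
    ∫ x, shiftDensityPi v a x ^ 2 ∂(Measure.pi fun _ : Fin n => gaussianReal 0 v) =
      Real.exp ((∑ i, a i ^ 2) / v) := by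
  simp_rw [shiftDensityPi, ← Finset.prod_pow]
  rw [integral_fintype_prod_eq_prod (f := fun i x => shiftDensity v (a i) x ^ 2)]
  simp [integral_shiftDensity_sq hv, ← Real.exp_sum, Finset.sum_div]

lemma pi_gaussianReal_eq_withDensity (hv : v ≠ 0) (a : Fin n → ℝ) :
    Measure.pi (fun i => gaussianReal (a i) v) =
      (Measure.pi fun _ : Fin n => gaussianReal 0 v).withDensity
        (fun x => ENNReal.ofReal (shiftDensityPi v a x)) := by
  refine (Measure.pi_eq fun s hs => ?_)
  rw [withDensity_apply _ (MeasurableSet.univ_pi hs),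
    ← ofReal_integral_eq_lintegral_ofReal (integrable_shiftDensityPi a).integrableOn
      (Filter.Eventually.of_forall (shiftDensityPi_nonneg a)), Measure.restrict_pi_pi]
  simp_rw [shiftDensityPi]
  rw [integral_fintype_prod_eq_prod, ENNReal.ofReal_prod_of_nonneg
    fun i _ => integral_nonneg fun x => (shiftDensity_pos _ _ _).le]
  refine Finset.prod_congr rfl fun i _ => ?_
  rw [gaussianReal_eq_withDensity hv (a i), withDensity_apply _ (hs i),
    ofReal_integral_eq_lintegral_ofReal (integrable_shiftDensity v (a i)).integrableOn
      (Filter.Eventually.of_forall fun x => (shiftDensity_pos _ _ _).le)]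

/-- A dimension free bound for the total variation distance of two shifted Gaussian laws. -/
lemma pi_gaussianReal_shift_le (hv : v ≠ 0) (a : Fin n → ℝ) {s : ℝ} (hs : 0 < s)
    {A : Set (Fin n → ℝ)} (hA : MeasurableSet A) :
    Measure.pi (fun i => gaussianReal (a i) v) A ≤
      Measure.pi (fun _ : Fin n => gaussianReal 0 v) A +
        ENNReal.ofReal ((∑ i, a i ^ 2) / v / s + s / 2) := by
  set μ := Measure.pi (fun _ : Fin n => gaussianReal 0 v) with hμ
  set t := (∑ i, a i ^ 2) / (v : ℝ) with ht
  have ht0 : 0 ≤ t := by positivity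
  -- For `t ≤ 1` the chi-square divergence `exp t - 1` is at most `2t`; for `t > 1` the claimed
  -- bound already exceeds 1.
  rcases le_or_gt t 1 with h1 | h1
  · have hi : Integrable (fun x => (shiftDensityPi v a x - 1) ^ 2) μ := by
      have := ((integrable_shiftDensityPi_sq (v := v) a).sub
        ((integrable_shiftDensityPi a).const_mul 2)).add (integrable_const (1 : ℝ))
      refine this.congr (Filter.Eventually.of_forall fun x => ?_)
      simp only [Pi.add_apply, Pi.sub_apply]
      ring
    have hsq : ∫ x, (shiftDensityPi v a x - 1) ^ 2 ∂μ = Real.exp t - 1 := by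
      have h (x : Fin n → ℝ) : (shiftDensityPi v a x - 1) ^ 2 =
          shiftDensityPi v a x ^ 2 - 2 * shiftDensityPi v a x + 1 := by ring
      have hsub : Integrable (fun x => shiftDensityPi v a x ^ 2 - 2 * shiftDensityPi v a x) μ :=
        (integrable_shiftDensityPi_sq a).sub ((integrable_shiftDensityPi a).const_mul 2)
      simp_rw [h]
      rw [integral_add hsub (integrable_const _),
        integral_sub (integrable_shiftDensityPi_sq a) ((integrable_shiftDensityPi a).const_mul 2),
        integral_const_mul, integral_shiftDensityPi hv, integral_shiftDensityPi_sq hv]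
      simp
      ring
    have hexp : Real.exp t - 1 ≤ 2 * t := by
      have := Real.abs_exp_sub_one_le (x := t) (by rwa [abs_of_nonneg ht0])
      rw [abs_of_nonneg ht0] at this
      exact (le_abs_self _).trans this
    -- AM-GM: `L - 1 ≤ (L - 1)²/(2s) + s/2` for the likelihood ratio `L`.
    have key : ∫⁻ x in A, ENNReal.ofReal (shiftDensityPi v a x) ∂μ ≤
        ∫⁻ x in A, (1 + ENNReal.ofReal ((shiftDensityPi v a x - 1) ^ 2 / (2 * s) + s / 2)) ∂μ := by
      refine lintegral_mono fun x => ?_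
      rw [← ENNReal.ofReal_one, ← ENNReal.ofReal_add zero_le_one (by positivity)]
      refine ENNReal.ofReal_le_ofReal ?_
      have : 0 ≤ (shiftDensityPi v a x - 1 - s) ^ 2 / (2 * s) := by positivity
      have h2 : (shiftDensityPi v a x - 1 - s) ^ 2 / (2 * s) =
          (shiftDensityPi v a x - 1) ^ 2 / (2 * s) + s / 2 - (shiftDensityPi v a x - 1) := by
        field_simp; ring
      linarith
    rw [pi_gaussianReal_eq_withDensity hv, withDensity_apply _ hA]
    refine key.trans ?_
    rw [lintegral_add_left measurable_const]
    simp only [lintegral_const, one_mul, Measure.restrict_apply_univ]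
    gcongr
    refine (setLIntegral_le_lintegral _ _).trans ?_
    have hi' : Integrable (fun x => (shiftDensityPi v a x - 1) ^ 2 / (2 * s) + s / 2) μ :=
      (hi.div_const _).add (integrable_const _)
    rw [← ofReal_integral_eq_lintegral_ofReal hi'
      (Filter.Eventually.of_forall fun x => by dsimp only [Pi.zero_apply]; positivity)]
    refine ENNReal.ofReal_le_ofReal ?_
    rw [integral_add (hi.div_const _) (integrable_const _), integral_div, hsq]
    simp only [integral_const, probReal_univ, one_smul]
    gcongr ?_ + _
    rw [div_le_div_iff₀ (by positivity) hs]
    nlinarith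
  · refine (prob_le_one).trans (le_add_left ?_)
    rw [ENNReal.one_le_ofReal]
    have : 1 / s + s / 2 ≤ t / s + s / 2 := by gcongr
    refine le_trans ?_ this
    rw [div_add_div _ _ hs.ne' two_ne_zero, le_div_iff₀ (by positivity)]
    nlinarith [sq_nonneg (s - 1)]

end Pi

/-! ### Second moments of the design. -/

/-- The diagonal entry is `‖Σ^{1/2} e_j‖²`. -/
lemma diag_le_sqrtOpNorm_sq {p : ℕ} {Sig : Matrix (Fin p) (Fin p) ℝ} (hSig : Sig.PosSemidef)
    (j : Fin p) : Sig j j ≤ sqrtOpNorm Sig ^ 2 := by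
  set T := Matrix.toEuclideanCLM (𝕜 := ℝ) (CFC.sqrt Sig) with hT
  set e : EuclideanSpace ℝ (Fin p) := EuclideanSpace.single j 1 with he
  have hsa : IsSelfAdjoint T := (CFC.sqrt_nonneg Sig).isSelfAdjoint.map _
  have h1 : Sig j j = inner ℝ e (Matrix.toEuclideanCLM (𝕜 := ℝ) Sig e) := by
    rw [Matrix.inner_toEuclideanCLM]
    simp [he]
  have h2 : Matrix.toEuclideanCLM (𝕜 := ℝ) Sig = T * T := by
    rw [hT, ← map_mul, CFC.sqrt_mul_sqrt_self _ hSig.nonneg]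
  have h3 : Sig j j = ‖T e‖ ^ 2 := by
    rw [h1, h2, mul_apply_eq_comp, ← ContinuousLinearMap.adjoint_inner_left,
      hsa.adjoint_eq, real_inner_self_eq_norm_sq]
  have h4 : ‖T e‖ ≤ ‖T‖ := by
    simpa [he] using T.le_opNorm e
  rw [h3, sqrtOpNorm]
  gcongr

lemma memLp_eval_multivariateGaussian {p : ℕ} (Sig : Matrix (Fin p) (Fin p) ℝ) (j : Fin p) :
    MemLp (fun x : EuclideanSpace ℝ (Fin p) => x j) 2 (multivariateGaussian 0 Sig) :=
  (EuclideanSpace.proj (𝕜 := ℝ) j).comp_memLp' IsGaussian.memLp_two_id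

lemma integral_eval_sq_multivariateGaussian {p : ℕ} {Sig : Matrix (Fin p) (Fin p) ℝ}
    (hSig : Sig.PosSemidef) (j : Fin p) :
    ∫ x, x j ^ 2 ∂(multivariateGaussian 0 Sig) = Sig j j := by
  have hm : ∫ x, x j ∂(multivariateGaussian 0 Sig) = 0 := by
    have := (EuclideanSpace.proj (𝕜 := ℝ) j).integral_comp_id_comm
      (IsGaussian.integrable_id (μ := multivariateGaussian 0 Sig))
    simpa using this
  rw [← variance_eval_multivariateGaussian (μ := 0) hSig j, variance_eq_sub
    (memLp_eval_multivariateGaussian Sig j), hm]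
  simp

lemma integrable_eval_sq_multivariateGaussian {p : ℕ} (Sig : Matrix (Fin p) (Fin p) ℝ)
    (j : Fin p) :
    Integrable (fun x : EuclideanSpace ℝ (Fin p) => x j ^ 2) (multivariateGaussian 0 Sig) :=
  (memLp_eval_multivariateGaussian Sig j).integrable_sq

lemma integrable_sum_eval_sq (n : ℕ) {p : ℕ} (Sig : Matrix (Fin p) (Fin p) ℝ) (j : Fin p) :
    Integrable (fun X : Fin n → EuclideanSpace ℝ (Fin p) => ∑ i, X i j ^ 2)
      (Measure.pi fun _ : Fin n => multivariateGaussian 0 Sig) :=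
  integrable_finsetSum _ fun i _ => integrable_comp_eval (i := i)
    (μ := fun _ : Fin n => multivariateGaussian 0 Sig) (f := fun x => x j ^ 2)
    (integrable_eval_sq_multivariateGaussian Sig j)

lemma integral_sum_eval_sq (n : ℕ) {p : ℕ} {Sig : Matrix (Fin p) (Fin p) ℝ}
    (hSig : Sig.PosSemidef) (j : Fin p) :
    ∫ X, ∑ i, X i j ^ 2 ∂(Measure.pi fun _ : Fin n => multivariateGaussian 0 Sig) =
      n * Sig j j := by
  have hi := integrable_eval_sq_multivariateGaussian Sig j
  rw [integral_finsetSum _ fun i _ => integrable_comp_eval (i := i) hi]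
  have (i : Fin n) : ∫ X, X i j ^ 2 ∂(Measure.pi fun _ : Fin n => multivariateGaussian 0 Sig) =
      Sig j j := by
    rw [integral_comp_eval (i := i) (μ := fun _ : Fin n => multivariateGaussian 0 Sig)
      (f := fun x => x j ^ 2) hi.aestronglyMeasurable, integral_eval_sq_multivariateGaussian hSig]
  simp [this]

/-! ### The data law under a shift of the parameter. -/

lemma measurable_response (n : ℕ) {p : ℕ} (β : EuclideanSpace ℝ (Fin p)) :
    Measurable fun z : Data n p => ((z.1, fun i => inner ℝ (z.1 i) β + z.2 i) : Data n p) := by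
  fun_prop

instance isProbabilityMeasure_dataLaw (n : ℕ) {p : ℕ} (Sig : Matrix (Fin p) (Fin p) ℝ) (σ : ℝ)
    (β : EuclideanSpace ℝ (Fin p)) : IsProbabilityMeasure (dataLaw n Sig σ β) :=
  Measure.isProbabilityMeasure_map (measurable_response n β).aemeasurable

/-- Given `X`, the shift `d` is absorbed into the mean of the noise, so that the event in `e`
depends on `β` alone. -/
lemma dataLaw_add_apply (n : ℕ) {p : ℕ} (Sig : Matrix (Fin p) (Fin p) ℝ) (σ : ℝ)
    (β d : EuclideanSpace ℝ (Fin p)) {A : Set (Data n p)} (hA : MeasurableSet A) :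
    dataLaw n Sig σ (β + d) A =
      ∫⁻ X, Measure.pi (fun i => gaussianReal (inner ℝ (X i) d) (σ ^ 2).toNNReal)
        {e | ((X, fun i => inner ℝ (X i) β + e i) : Data n p) ∈ A}
        ∂(Measure.pi fun _ : Fin n => multivariateGaussian 0 Sig) := by
  rw [dataLaw, Measure.map_apply (measurable_response n _) hA,
    Measure.prod_apply (measurable_response n _ hA)]
  refine lintegral_congr fun X => ?_
  have hshift : Measure.pi (fun i => gaussianReal (inner ℝ (X i) d) (σ ^ 2).toNNReal) =
      (Measure.pi fun _ : Fin n => gaussianReal 0 (σ ^ 2).toNNReal).map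
        fun e i => e i + inner ℝ (X i) d := by
    rw [Measure.pi_map_pi (f := fun i e => e + inner ℝ (X i) d) (fun i => by fun_prop)]
    simp [gaussianReal_map_add_const]
  have hm : MeasurableSet {e : Fin n → ℝ | ((X, fun i => inner ℝ (X i) β + e i) : Data n p) ∈ A} :=
    ((measurable_response n β).comp measurable_prodMk_left) hA
  rw [hshift, Measure.map_apply (by fun_prop) hm]
  congr 1
  ext e
  simp only [Set.mem_preimage, Set.mem_ofPred_eq, inner_add_right]
  simp only [add_assoc, add_comm (e _)]

lemma dataLaw_apply (n : ℕ) {p : ℕ} (Sig : Matrix (Fin p) (Fin p) ℝ) (σ : ℝ)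
    (β : EuclideanSpace ℝ (Fin p)) {A : Set (Data n p)} (hA : MeasurableSet A) :
    dataLaw n Sig σ β A =
      ∫⁻ X, Measure.pi (fun _ => gaussianReal 0 (σ ^ 2).toNNReal)
        {e | ((X, fun i => inner ℝ (X i) β + e i) : Data n p) ∈ A}
        ∂(Measure.pi fun _ : Fin n => multivariateGaussian 0 Sig) := by
  simpa using dataLaw_add_apply n Sig σ β 0 hA

/-- Moving the parameter by `h e_j` raises probabilities by at most `√2 δ`, where `δ` bounds
`√(n Σ_jj) |h| / σ`. -/
lemma dataLaw_add_single_le (n : ℕ) {p : ℕ} {Sig : Matrix (Fin p) (Fin p) ℝ}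
    (hSig : Sig.PosSemidef) {σ : ℝ} (hσ : 0 < σ) (β : EuclideanSpace ℝ (Fin p)) (j : Fin p)
    {h δ : ℝ} (hδ : 0 < δ) (hh : n * (h ^ 2 * Sig j j) ≤ δ ^ 2 * σ ^ 2)
    {A : Set (Data n p)} (hA : MeasurableSet A) :
    dataLaw n Sig σ (β + EuclideanSpace.single j h) A ≤
      dataLaw n Sig σ β A + ENNReal.ofReal (√2 * δ) := by
  have hv : (σ ^ 2).toNNReal ≠ 0 := by simpa using hσ.ne'
  have hvc : ((σ ^ 2).toNNReal : ℝ) = σ ^ 2 := Real.coe_toNNReal _ (by positivity)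
  -- The choice `s = √2 δ` balances the two terms: `δ²/s = s/2 = δ/√2`.
  have hs : 0 < √2 * δ := by positivity
  set ν := Measure.pi fun _ : Fin n => multivariateGaussian 0 Sig with hν
  rw [dataLaw_add_apply n Sig σ β _ hA, dataLaw_apply n Sig σ β hA]
  have hInt : Integrable (fun X : Fin n → EuclideanSpace ℝ (Fin p) =>
      h ^ 2 * (∑ i, X i j ^ 2) / σ ^ 2 / (√2 * δ) + √2 * δ / 2) ν :=
    ((((integrable_sum_eval_sq n Sig j).const_mul _).div_const _).div_const _).add
      (integrable_const _)
  have hval : ∫⁻ X, ENNReal.ofReal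
      (h ^ 2 * (∑ i, X i j ^ 2) / σ ^ 2 / (√2 * δ) + √2 * δ / 2) ∂ν ≤
        ENNReal.ofReal (√2 * δ) := by
    rw [← ofReal_integral_eq_lintegral_ofReal hInt
      (Filter.Eventually.of_forall fun X => by dsimp only [Pi.zero_apply]; positivity)]
    refine ENNReal.ofReal_le_ofReal ?_
    rw [integral_add ((((integrable_sum_eval_sq n Sig j).const_mul _).div_const _).div_const _)
      (integrable_const _), integral_div, integral_div, integral_const_mul,
      integral_sum_eval_sq n hSig]
    simp only [integral_const, probReal_univ, one_smul]
    have h1 : h ^ 2 * (n * Sig j j) / σ ^ 2 ≤ δ ^ 2 := by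
      rw [div_le_iff₀ (by positivity)]; linarith
    have h2 : h ^ 2 * (n * Sig j j) / σ ^ 2 / (√2 * δ) ≤ √2 * δ / 2 := by
      rw [div_le_div_iff₀ hs two_pos]
      nlinarith [Real.mul_self_sqrt (show (0 : ℝ) ≤ 2 by norm_num)]
    linarith
  refine le_trans (lintegral_mono fun X => ?_)
    ((lintegral_add_right' _ hInt.1.aemeasurable.ennreal_ofReal).le.trans
      (add_le_add_right hval _))
  have hm : MeasurableSet {e : Fin n → ℝ | ((X, fun i => inner ℝ (X i) β + e i) : Data n p) ∈ A} :=
    ((measurable_response n β).comp measurable_prodMk_left) hA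
  refine (pi_gaussianReal_shift_le hv _ hs hm).trans (le_of_eq ?_)
  simp [hvc, EuclideanSpace.inner_single_right, mul_pow, Finset.mul_sum]

/-! ### The two-point lower bound. -/

lemma measurableSet_cover {n p : ℕ} (I : DataInterval n p) (b : ℝ) :
    MeasurableSet {z | I.lower z ≤ b ∧ b ≤ I.upper z} :=
  (measurableSet_le I.measurable_lower measurable_const).inter
    (measurableSet_le measurable_const I.measurable_upper)

/-- The two point bound: an interval that is valid at `β` and at `β + h e_j` has expected length
at least `|h| (1 - 2 α - √2 δ)` at `β`, where `δ` bounds `√(n Σ_jj) |h| / σ`. -/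
lemma le_worstLength_of_shift {n p : ℕ} {Sig : Matrix (Fin p) (Fin p) ℝ}
    (hSig : Sig.PosSemidef) {σ : ℝ} (hσ : 0 < σ) {β : EuclideanSpace ℝ (Fin p)} {j : Fin p}
    {h δ : ℝ} (hδ : 0 < δ) (hh : n * (h ^ 2 * Sig j j) ≤ δ ^ 2 * σ ^ 2)
    {Θ : Set (EuclideanSpace ℝ (Fin p))} (hβ : β ∈ Θ)
    (hβ' : β + EuclideanSpace.single j h ∈ Θ) {α : ℝ}
    {I : DataInterval n p} (hI : I ∈ validIntervals n Sig σ j α Θ) :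
    ENNReal.ofReal (|h| * (1 - 2 * α - √2 * δ)) ≤ worstLength Sig σ I Θ := by
  set P := dataLaw n Sig σ β with hP
  set β' := β + EuclideanSpace.single j h with hβ'_def
  set A := {z | I.lower z ≤ β j ∧ β j ≤ I.upper z}
  set A' := {z | I.lower z ≤ β' j ∧ β' j ≤ I.upper z}
  have hA : MeasurableSet A := measurableSet_cover I _
  have hA' : MeasurableSet A' := measurableSet_cover I _
  have hcov : ∀ b ∈ Θ, ENNReal.ofReal (1 - α) ≤
      dataLaw n Sig σ b {z | I.lower z ≤ b j ∧ b j ≤ I.upper z} := fun b hb =>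
    le_trans hI (iInf₂_le b hb)
  have h1 : 1 - α ≤ P.real A :=
    (ENNReal.ofReal_le_iff_le_toReal (measure_ne_top _ _)).1 (hcov β hβ)
  have h2 : 1 - α ≤ P.real A' + √2 * δ := by
    have := (hcov β' hβ').trans (dataLaw_add_single_le n hSig hσ β j hδ hh hA')
    have h3 := (ENNReal.ofReal_le_iff_le_toReal (by finiteness)).1 this
    rwa [ENNReal.toReal_add (measure_ne_top _ _) ENNReal.ofReal_ne_top,
      ENNReal.toReal_ofReal (by positivity)] at h3
  have h3 : P.real A + P.real A' ≤ 1 + P.real (A ∩ A') := by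
    rw [← measureReal_union_add_inter hA']
    gcongr
    exact measureReal_le_one
  have hlen : ∀ z ∈ A ∩ A', |h| ≤ I.upper z - I.lower z := by
    rintro z ⟨⟨ha, hb⟩, hc, hd⟩
    have : β' j = β j + h := by simp [hβ'_def]
    rw [this] at hc hd
    rw [abs_le]
    constructor <;> linarith
  calc ENNReal.ofReal (|h| * (1 - 2 * α - √2 * δ))
      ≤ ENNReal.ofReal (|h| * P.real (A ∩ A')) := by
        refine ENNReal.ofReal_le_ofReal (mul_le_mul_of_nonneg_left ?_ (abs_nonneg _))
        linarith
    _ = ∫⁻ _ in A ∩ A', ENNReal.ofReal |h| ∂P := by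
        rw [ENNReal.ofReal_mul (abs_nonneg _), setLIntegral_const, ofReal_measureReal]
    _ ≤ ∫⁻ z in A ∩ A', ENNReal.ofReal (I.upper z - I.lower z) ∂P :=
        setLIntegral_mono' (hA.inter hA') fun z hz => ENNReal.ofReal_le_ofReal (hlen z hz)
    _ ≤ ∫⁻ z, ENNReal.ofReal (I.upper z - I.lower z) ∂P := setLIntegral_le_lintegral _ _
    _ ≤ worstLength Sig σ I Θ :=
        le_iSup₂ (f := fun b (_ : b ∈ Θ) =>
          ∫⁻ z, ENNReal.ofReal (I.upper z - I.lower z) ∂(dataLaw n Sig σ b)) β hβ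

/-! ### Choosing the two points. -/

lemma exists_shift_of_mem_shiftable {n p : ℕ} {K : Set (EuclideanSpace ℝ (Fin p))}
    {Sig : Matrix (Fin p) (Fin p) ℝ} {σ δ : ℝ} {j : Fin p} {β : EuclideanSpace ℝ (Fin p)}
    (hβ : β ∈ shiftable n K Sig σ δ j) :
    ∃ h : ℝ, |h| = |δ * σ * (sqrtOpNorm Sig)⁻¹ / √(n : ℝ)| ∧
      β + EuclideanSpace.single j h ∈ K := by
  rcases hβ.2 with h | h
  · exact ⟨_, rfl, h⟩
  · refine ⟨-(δ * σ * (sqrtOpNorm Sig)⁻¹ / √(n : ℝ)), abs_neg _, ?_⟩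
    have : EuclideanSpace.single j (-(δ * σ * (sqrtOpNorm Sig)⁻¹ / √(n : ℝ))) =
        -EuclideanSpace.single j (δ * σ * (sqrtOpNorm Sig)⁻¹ / √(n : ℝ)) := by
      ext i; by_cases hi : i = j <;> simp [hi]
    rwa [this, ← sub_eq_add_neg]

/-- Turns divergence of `wbar` into positivity of the rate and a lower bound on `R`. -/
lemma ofReal_le_rate {n p : ℕ} {K : Set (EuclideanSpace ℝ (Fin p))}
    {wbar : EuclideanSpace ℝ (Fin p) → ℝ} {Sig : Matrix (Fin p) (Fin p) ℝ} {σ δ : ℝ} {j : Fin p}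
    {M : ℝ} (hM : 0 ≤ M) (hw : ∀ v ∈ K, M ≤ wbar v) :
    ENNReal.ofReal (M ^ 2 / √(n : ℝ)) ≤ rate n K wbar Sig σ δ j := by
  refine le_iInf₂ fun β hβ => ENNReal.ofReal_le_ofReal ?_
  have := hw β hβ.1
  gcongr

/-- The infimum need not be attained: the factor 2 gives a strict gap because the rate is positive
and finite. Finiteness also excludes an empty `shiftable`. -/
lemma exists_mem_shiftable_of_two_mul_rate_le {n p : ℕ} {K : Set (EuclideanSpace ℝ (Fin p))}
    {wbar : EuclideanSpace ℝ (Fin p) → ℝ} {Sig : Matrix (Fin p) (Fin p) ℝ} {σ δ : ℝ} {j : Fin p}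
    {R : ℝ} (hn : 0 < n) (hpos : 0 < rate n K wbar Sig σ δ j)
    (hR : 2 * rate n K wbar Sig σ δ j ≤ ENNReal.ofReal R) :
    ∃ β ∈ shiftable n K Sig σ δ j, wbar β ^ 2 ≤ R * √(n : ℝ) := by
  have hsn : 0 < √(n : ℝ) := by positivity
  have hfin : rate n K wbar Sig σ δ j ≠ ⊤ := by
    intro h
    rw [h] at hR
    simp at hR
  have hlt : rate n K wbar Sig σ δ j < ENNReal.ofReal R := by
    refine lt_of_lt_of_le ?_ hR
    rw [two_mul]
    exact ENNReal.lt_add_right hfin hpos.ne'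
  obtain ⟨β, hβ, h⟩ := by simpa only [rate, iInf_lt_iff] using hlt
  refine ⟨β, hβ, ?_⟩
  rw [← div_le_iff₀ hsn]
  exact ((ENNReal.ofReal_lt_ofReal_iff' ).1 h).1.le

end DebiasCI

theorem mainTheorem8
    -- the dimension, the constraint set, the covariance and the coordinate may vary with `n`
    (p : ℕ → ℕ) (K : (n : ℕ) → Set (EuclideanSpace ℝ (Fin (p n))))
    (hK : ∀ n, Convex ℝ (K n))
    (Sig : (n : ℕ) → Matrix (Fin (p n)) (Fin (p n)) ℝ) (hSig : ∀ n, (Sig n).PosSemidef)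
    (c : ℝ) (hc : 0 < c) (hSigc : ∀ n, c ≤ DebiasCI.sqrtOpNorm (Sig n))
    (σ : ℝ) (hσ : 0 < σ) (j : (n : ℕ) → Fin (p n))
    (α : ℝ) (hα : α ∈ Set.Ioo (0 : ℝ) 1) (δ : ℝ) (hδ : 0 < δ)
    -- `wbar n v` is an upper bound of `w(T_K(v) ∩ S^{p-1})` that diverges uniformly over `v ∈ K`
    (wbar : (n : ℕ) → EuclideanSpace ℝ (Fin (p n)) → ℝ)
    (hwbar : ∀ n, ∀ v ∈ K n, DebiasCI.tangentComplexity (K n) v ≤ wbar n v)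
    (hwbar_div : ∀ M : ℝ, ∀ᶠ n in Filter.atTop, ∀ v ∈ K n, M ≤ wbar n v)
    (hr : Filter.Tendsto (fun n => DebiasCI.rate n (K n) (wbar n) (Sig n) σ δ (j n))
      Filter.atTop (nhds 0))
    (R : ℕ → ℝ)
    (hRr : ∀ᶠ n in Filter.atTop,
      2 * DebiasCI.rate n (K n) (wbar n) (Sig n) σ δ (j n) ≤ ENNReal.ofReal (R n))
    (hR : Filter.Tendsto R Filter.atTop (nhds 0)) :
    ∀ᶠ n : ℕ in Filter.atTop,
      ENNReal.ofReal (δ * (1 - 2 * α - √(Real.exp (2 * δ ^ 2) - 1)) *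
          (σ * (DebiasCI.sqrtOpNorm (Sig n))⁻¹ / √(n : ℝ))) ≤
        ⨅ I ∈ DebiasCI.validIntervals n (Sig n) σ (j n) α
            (DebiasCI.paramSpace n (K n) (wbar n) (R n)),
          DebiasCI.worstLength (Sig n) σ I
            (DebiasCI.paramSpace n (K n) (wbar n) (R n)) := by

  -- The threshold `δσ/c` dominates `√n |h| = δσ/s`, so the lower bound on `R` will give `h² ≤
  -- R/√n`.
  have hM : 0 < δ * σ / c := by positivity
  filter_upwards [hwbar_div (δ * σ / c), hRr, Filter.eventually_gt_atTop 0] with n hw hRn hn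
  have hnR : (0 : ℝ) < n := by exact_mod_cast hn
  have hsn : 0 < √(n : ℝ) := Real.sqrt_pos.2 hnR
  set s := DebiasCI.sqrtOpNorm (Sig n) with hs_def
  have hs : 0 < s := hc.trans_le (hSigc n)
  have hrate := DebiasCI.ofReal_le_rate (n := n) (Sig := Sig n) (σ := σ) (δ := δ) (j := j n)
    hM.le hw
  have hpos : 0 < DebiasCI.rate n (K n) (wbar n) (Sig n) σ δ (j n) :=
    lt_of_lt_of_le (ENNReal.ofReal_pos.2 (by positivity)) hrate
  obtain ⟨β, hβ, hwβ⟩ := DebiasCI.exists_mem_shiftable_of_two_mul_rate_le hn hpos hRn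
  obtain ⟨h, habs, hβ'⟩ := DebiasCI.exists_shift_of_mem_shiftable hβ
  rw [← hs_def, abs_of_pos (show 0 < δ * σ * s⁻¹ / √(n : ℝ) by positivity)] at habs
  have hsq : h ^ 2 = (δ * σ / s) ^ 2 / n := by
    rw [← sq_abs, habs, div_pow, Real.sq_sqrt hnR.le, div_eq_mul_inv (δ * σ) s]
  have hRlow : (δ * σ / c) ^ 2 / √(n : ℝ) ≤ R n := by
    have h1 : ENNReal.ofReal ((δ * σ / c) ^ 2 / √(n : ℝ)) ≤ ENNReal.ofReal (R n) :=
      hrate.trans ((le_mul_of_one_le_left' one_le_two).trans hRn)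
    rcases (ENNReal.ofReal_le_ofReal_iff').1 h1 with h2 | h2
    · exact h2
    · exact absurd h2 (not_le.2 (by positivity))
  have hR0 : 0 ≤ R n := le_trans (by positivity) hRlow
  have hshift : h ^ 2 ≤ R n / √(n : ℝ) := by
    rw [hsq, le_div_iff₀ hsn]
    refine le_trans ?_ hRlow
    have h1 : δ * σ / s ≤ δ * σ / c := by
      have := hSigc n
      gcongr
    calc (δ * σ / s) ^ 2 / n * √(n : ℝ) = (δ * σ / s) ^ 2 / √(n : ℝ) := by
          rw [div_mul_eq_mul_div, div_eq_div_iff hnR.ne' hsn.ne', mul_assoc,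
            Real.mul_self_sqrt hnR.le]
      _ ≤ (δ * σ / c) ^ 2 / √(n : ℝ) := by gcongr
  -- The centre `v = β` witnesses membership of both points.
  have hmem : β ∈ DebiasCI.paramSpace n (K n) (wbar n) (R n) :=
    ⟨hβ.1, β, hβ.1, by simpa using div_nonneg hR0 hsn.le, hwβ⟩
  have hmem' : β + EuclideanSpace.single (j n) h ∈
      DebiasCI.paramSpace n (K n) (wbar n) (R n) :=
    ⟨hβ', β, hβ.1, by simpa using hshift, hwβ⟩
  have hvar : n * (h ^ 2 * Sig n (j n) (j n)) ≤ δ ^ 2 * σ ^ 2 := by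
    calc n * (h ^ 2 * Sig n (j n) (j n)) ≤ n * (h ^ 2 * s ^ 2) := by
          have := DebiasCI.diag_le_sqrtOpNorm_sq (hSig n) (j n)
          gcongr
      _ = δ ^ 2 * σ ^ 2 := by rw [hsq]; field_simp
  have hexp : √2 * δ ≤ √(Real.exp (2 * δ ^ 2) - 1) := by
    refine Real.le_sqrt_of_sq_le ?_
    rw [mul_pow, Real.sq_sqrt zero_le_two]
    linarith [Real.add_one_le_exp (2 * δ ^ 2)]
  refine le_iInf₂ fun I hI => le_trans (ENNReal.ofReal_le_ofReal ?_)
    (DebiasCI.le_worstLength_of_shift (hSig n) hσ hδ hvar hmem hmem' hI)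
  rw [habs]
  calc δ * (1 - 2 * α - √(Real.exp (2 * δ ^ 2) - 1)) * (σ * s⁻¹ / √(n : ℝ))
      = δ * σ * s⁻¹ / √(n : ℝ) * (1 - 2 * α - √(Real.exp (2 * δ ^ 2) - 1)) := by ring
    _ ≤ δ * σ * s⁻¹ / √(n : ℝ) * (1 - 2 * α - √2 * δ) := by gcongr
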